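/- Let $X_1,X_2,\dots$ be i.i.d. real random variables that are $h$-lattice valued, i.e. $\sum_{k\in\mathbf Z}\mathbf P(X_i=kh+b)=1$ for some $h>0$ and $b\in\mathbf R$, where $h$ is the maximal number with this property (over all possible choices of the shift). Suppose that $\mathbf E X_i=0$, $\mathbf E X_i^2=\sigma^2$ with $\sigma>0$, and $\mathbf E|X_i|^3<\infty$. Let $S_n=\sum_{i=1}^n X_i$ and $a\in\mathbf R$, and read "$S_k=a\sigma\sqrt k$" as $$S_k=\left\lfloor\frac{a\sigma\sqrt k-kb}{h}\right\rfloor h+kb .$$ Then $$\frac1{\log n}\sum_{k=1}^n 1_{\{S_k=a\sigma\sqrt k\}}\,\frac1{\sqrt k}\;\longrightarrow\;\frac{h}{\sqrt{2\pi}\,\sigma}\,e^{-a^2/2}\quad\text{almost surely as } n\to\infty.$$ -/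

import Mathlib

open MeasureTheory ProbabilityTheory Filter Topology

/-- The random variable `Y` is concentrated on the arithmetic progression `h ℤ + b`:
`∑_{k ∈ ℤ} P(Y = k h + b) = 1`. -/
def IsConcentratedOnLattice {Ω : Type*} [MeasurableSpace Ω] (μ : Measure Ω) (Y : Ω → ℝ)
    (h b : ℝ) : Prop :=
  ∑' k : ℤ, μ {ω | Y ω = (k : ℝ) * h + b} = 1

/-- `Y` is `h`-lattice valued, with shift `b`: it is concentrated on `h ℤ + b`, where `h > 0` is
maximal among all the spans `h'` of progressions `h' ℤ + b'` on which `Y` is concentrated. -/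
structure IsLatticeValued {Ω : Type*} [MeasurableSpace Ω] (μ : Measure Ω) (Y : Ω → ℝ)
    (h b : ℝ) : Prop where
  pos : 0 < h
  concentrated : IsConcentratedOnLattice μ Y h b
  maximal : ∀ h' b' : ℝ, 0 < h' → IsConcentratedOnLattice μ Y h' b' → h' ≤ h

/-- The random walk `S_n`, the sum of the first `n` steps; the steps `X_1, X_2, …` are
`X 0, X 1, …`. -/
def partialSum {Ω : Type*} (X : ℕ → Ω → ℝ) (n : ℕ) (ω : Ω) : ℝ :=
  ∑ i ∈ Finset.range n, X i ω

/-- The lattice approximation `[(t - n b) / h] h + n b` of the real number `t` in the lattice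
`h ℤ + n b` of possible values of `S_n`. -/
noncomputable def latticeApprox (h b : ℝ) (n : ℕ) (t : ℝ) : ℝ :=
  (⌊(t - (n : ℝ) * b) / h⌋ : ℝ) * h + (n : ℝ) * b

/-- The event `S_k = a σ √k`, read as: `S_k` equals the lattice approximation of `a σ √k`. -/
def hitEvent {Ω : Type*} (X : ℕ → Ω → ℝ) (h b σ a : ℝ) (k : ℕ) : Set Ω :=
  {ω | partialSum X k ω = latticeApprox h b k (a * σ * √(k : ℝ))}

/-! Let `A k` be the event that `S_k` hits its target lattice point, and `T n` the sum of `1_{A k} /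
√k` over `1 ≤ k ≤ n`. The proof is a second-moment argument on the logarithmic scale.

Mean: by the local limit theorem, `√k * P(A k)` tends to the claimed constant. Since `E 1_{A k} / √k
= (√k * P(A k)) / k`, the mean of `T n` divided by `log n` is a logarithmic average of this
convergent sequence and has the same limit.

Variance: for `j < k` and `m = k - j`, independence of increments gives `cov(1_{A j}, 1_{A k}) = P(A
j) * (P(S_m = x - y) - P(S_k = x))`, where `y` and `x` are the targets at times `j` and `k`. Fourier
inversion writes the bracket as an integral over `[-π/h, π/h]`, where the characteristic function
has modulus at most `exp (-c t²)`: near `0` by Taylor expansion, elsewhere by maximality of the span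
and compactness. The covariance is thus `O(1 / (√m √k))`
(`IsCenteredLatticeWalk.exists_abs_cov_hitEvent_le`). After weighting by `1 / (√j √k)`, a discrete
Beta sum bounds each row by `O(1 / k)`, so `Var (T n) = O(log n)`.

Almost sure convergence: along `n = 2 ^ (i²)` the normalised variances are `O(1 / i²)`, hence
summable, and monotonicity of `T` fills the gaps (`ae_tendsto_div_log_of_variance_le`). -/

/-! ### Elementary sums. -/

theorem sum_range_inv_sqrt_le (n : ℕ) : ∑ j ∈ Finset.range n, 1 / √((j : ℝ) + 1) ≤ 2 * √(n : ℝ) := by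
  induction n with
  | zero => simp
  | succ n ih =>
    rw [Finset.sum_range_succ]
    push_cast
    have h1 : 0 < √((n : ℝ) + 1) := Real.sqrt_pos.2 (by positivity)
    have h2 : √((n : ℝ) + 1) ^ 2 = n + 1 := Real.sq_sqrt (by positivity)
    have h3 : √(n : ℝ) ^ 2 = n := Real.sq_sqrt (by positivity)
    have h4 : 1 / √((n : ℝ) + 1) ≤ 2 * (√((n : ℝ) + 1) - √n) := by
      rw [div_le_iff₀ h1]
      nlinarith [sq_nonneg (√((n : ℝ) + 1) - √n)]
    linarith

/-- The left side equals `(1/√x + 1/√y) / (√x + √y)`, and the square root is subadditive. With `x +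
y = k` fixed, this splits the Beta sum into two single sums. -/
theorem inv_sqrt_mul_inv_sqrt_le {x y : ℝ} (hx : 0 < x) (hy : 0 < y) :
    1 / √x * (1 / √y) ≤ (1 / √x + 1 / √y) / √(x + y) := by
  have h1 : 0 < √x := Real.sqrt_pos.2 hx
  have h2 : 0 < √y := Real.sqrt_pos.2 hy
  have h3 : 0 < √(x + y) := Real.sqrt_pos.2 (by positivity)
  have h4 : √(x + y) ≤ √x + √y := by
    refine Real.sqrt_le_iff.2 ⟨by positivity, ?_⟩
    nlinarith [Real.sq_sqrt hx.le, Real.sq_sqrt hy.le]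
  rw [le_div_iff₀ h3]
  field_simp
  linarith

/-- A discrete analogue of the bound for the Beta integral with both parameters `1 / 2`. -/
theorem sum_Ico_inv_sqrt_mul_inv_sqrt_le (k : ℕ) :
    ∑ j ∈ Finset.Ico 1 k, 1 / √(j : ℝ) * (1 / √((k - j : ℕ) : ℝ)) ≤ 4 := by
  rcases Nat.eq_zero_or_pos k with rfl | hk
  · simp
  have hk' : (0 : ℝ) < √(k : ℝ) := Real.sqrt_pos.2 (by exact_mod_cast hk)
  have key : ∑ j ∈ Finset.Ico 1 k, 1 / √(j : ℝ) ≤ 2 * √(k : ℝ) := by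
    rw [Finset.sum_Ico_eq_sum_range]
    have := sum_range_inv_sqrt_le (k - 1)
    have h2 : √((k - 1 : ℕ) : ℝ) ≤ √(k : ℝ) := Real.sqrt_le_sqrt (by exact_mod_cast Nat.sub_le _ _)
    push_cast
    simp only [add_comm (1 : ℝ)]
    linarith
  have key2 : ∑ j ∈ Finset.Ico 1 k, 1 / √((k - j : ℕ) : ℝ) ≤ 2 * √(k : ℝ) := by
    refine le_trans (le_of_eq ?_) key
    refine Finset.sum_nbij' (fun j => k - j) (fun j => k - j) ?_ ?_ ?_ ?_ ?_ <;>
      simp only [Finset.mem_Ico] <;> intros <;> first | omega | rfl | trivial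
  calc _ ≤ ∑ j ∈ Finset.Ico 1 k, (1 / √(j : ℝ) + 1 / √((k - j : ℕ) : ℝ)) / √(k : ℝ) := by
        refine Finset.sum_le_sum fun j hj => ?_
        rw [Finset.mem_Ico] at hj
        have := inv_sqrt_mul_inv_sqrt_le (x := j) (y := ((k - j : ℕ) : ℝ))
          (by exact_mod_cast (by omega : 0 < j)) (by exact_mod_cast (by omega : 0 < k - j))
        have h2 : (j : ℝ) + ((k - j : ℕ) : ℝ) = k := by
          exact_mod_cast (by omega : j + (k - j) = k)
        rwa [h2] at this
    _ ≤ 4 := by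
        rw [← Finset.sum_div, Finset.sum_add_distrib, div_le_iff₀ hk']
        linarith

theorem sum_Icc_inv_le_one_add_log (n : ℕ) :
    ∑ k ∈ Finset.Icc 1 n, 1 / (k : ℝ) ≤ 1 + Real.log n := by
  have := harmonic_le_one_add_log n
  rw [harmonic_eq_sum_Icc] at this
  push_cast at this
  simpa using this

theorem log_le_sum_Icc_inv (n : ℕ) (hn : 1 ≤ n) :
    Real.log n ≤ ∑ k ∈ Finset.Icc 1 n, 1 / (k : ℝ) := by
  have := log_add_one_le_harmonic n
  rw [harmonic_eq_sum_Icc] at this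
  push_cast at this
  have h2 : Real.log n ≤ Real.log (n + 1) :=
    Real.log_le_log (by exact_mod_cast hn) (by linarith)
  simpa using h2.trans this

/-! ### Logarithmic averages and almost sure convergence from variance bounds. -/

/-- Logarithmic averages of a convergent sequence converge to the same limit. -/
theorem tendsto_log_average {u : ℕ → ℝ} {c : ℝ} (hu : Tendsto u atTop (𝓝 c)) :
    Tendsto (fun n : ℕ => (∑ k ∈ Finset.Icc 1 n, u k / k) / Real.log n) atTop (𝓝 c) := by
  have hlog : Tendsto (fun n : ℕ => Real.log n) atTop atTop :=
    Real.tendsto_log_atTop.comp tendsto_natCast_atTop_atTop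
  set H : ℕ → ℝ := fun n => ∑ k ∈ Finset.Icc 1 n, 1 / (k : ℝ) with hH
  have hHtop : Tendsto H atTop atTop := by
    refine tendsto_atTop_mono' _ ?_ hlog
    filter_upwards [eventually_ge_atTop 1] with n hn using log_le_sum_Icc_inv n hn
  have hHlog : Tendsto (fun n : ℕ => H n / Real.log n) atTop (𝓝 1) := by
    have h1 : Tendsto (fun n : ℕ => (Real.log n)⁻¹ + 1) atTop (𝓝 1) := by
      simpa using (tendsto_inv_atTop_zero.comp hlog).add_const 1
    refine tendsto_of_tendsto_of_tendsto_of_le_of_le' tendsto_const_nhds h1 ?_ ?_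
    · filter_upwards [hlog.eventually_gt_atTop 0, eventually_ge_atTop 1] with n hn h1
      rw [le_div_iff₀ hn, one_mul]
      exact log_le_sum_Icc_inv n h1
    · filter_upwards [hlog.eventually_gt_atTop 0] with n hn
      rw [div_le_iff₀ hn, add_mul, inv_mul_cancel₀ hn.ne', one_mul]
      exact sum_Icc_inv_le_one_add_log n
  have hsum (f : ℕ → ℝ) (n : ℕ) :
      ∑ k ∈ Finset.range n, f (k + 1) = ∑ k ∈ Finset.Icc 1 n, f k := by
    rw [Finset.range_eq_Ico, Finset.sum_Ico_add' f 0 n 1]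
    rfl
  have ho : (fun n => ∑ k ∈ Finset.range n, (u (k + 1) - c) / ((k + 1 : ℕ) : ℝ)) =o[atTop]
      fun n => ∑ k ∈ Finset.range n, 1 / ((k + 1 : ℕ) : ℝ) := by
    refine Asymptotics.IsLittleO.sum_range ?_ (fun n => by positivity) ?_
    · have h0 : (fun k => u (k + 1) - c) =o[atTop] fun _ => (1 : ℝ) := by
        rw [Asymptotics.isLittleO_one_iff]
        simpa using ((tendsto_add_atTop_iff_nat 1).2 hu).sub_const c
      simpa [div_eq_mul_inv] using
        h0.mul_isBigO (Asymptotics.isBigO_refl (fun k : ℕ => 1 / ((k + 1 : ℕ) : ℝ)) atTop)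
    · simpa only [hsum (fun k => 1 / (k : ℝ))] using hHtop
  simp only [hsum (fun k => 1 / (k : ℝ)), hsum (fun k => (u k - c) / (k : ℝ))] at ho
  have h1 := ho.tendsto_div_nhds_zero
  have h2 := (h1.add_const c).mul hHlog
  rw [zero_add, mul_one] at h2
  refine h2.congr' ?_
  filter_upwards [hHtop.eventually_gt_atTop 0] with n hn
  have h3 : ∑ k ∈ Finset.Icc 1 n, (u k - c) / (k : ℝ) =
      ∑ k ∈ Finset.Icc 1 n, u k / (k : ℝ) - c * H n := by
    rw [hH, Finset.mul_sum, ← Finset.sum_sub_distrib]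
    exact Finset.sum_congr rfl fun k _ => by ring
  simp only [h3]
  change (_ / H n + c) * _ = _
  field_simp
  ring

/-- A monotone process whose variance grows at most logarithmically and whose expectation, divided
by the logarithm, converges, converges almost surely after division by the logarithm. -/
theorem ae_tendsto_div_log_of_variance_le {Ω : Type*} [MeasurableSpace Ω] {μ : Measure Ω}
    [IsProbabilityMeasure μ] {T : ℕ → Ω → ℝ} {C c : ℝ} (hT : ∀ n, MemLp (T n) 2 μ)
    (hmono : ∀ ω, Monotone fun n => T n ω) (hnonneg : ∀ n ω, 0 ≤ T n ω)
    (hvar : ∀ n, 1 ≤ n → Var[T n; μ] ≤ C * (1 + Real.log n))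
    (hmean : Tendsto (fun n : ℕ => (∫ ω, T n ω ∂μ) / Real.log n) atTop (𝓝 c)) :
    ∀ᵐ ω ∂μ, Tendsto (fun n : ℕ => T n ω / Real.log n) atTop (𝓝 c) := by
  have hl2 : 0 < Real.log 2 := Real.log_pos one_lt_two
  -- Sparse enough that `Var / log²` is of order `1 / i²`, dense enough that the ratio of
  -- consecutive logarithms, `(i + 1)² / i²`, tends to `1`.
  set N : ℕ → ℕ := fun i => 2 ^ (i ^ 2)
  have hlogN (i : ℕ) : Real.log (N i) = (i : ℝ) ^ 2 * Real.log 2 := by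
    simp [N, Real.log_pow]
  have hNtop : Tendsto N atTop atTop :=
    (tendsto_pow_atTop_atTop_of_one_lt one_lt_two).comp (tendsto_pow_atTop two_ne_zero)
  set D : ℕ → Ω → ℝ := fun i ω => (T (N i) ω - ∫ ω', T (N i) ω' ∂μ) / (i : ℝ) ^ 2
  have hC : 0 ≤ C := by simpa using (variance_nonneg (T 1) μ).trans (hvar 1 le_rfl)
  have hDint (i : ℕ) : Integrable (fun ω => D i ω ^ 2) μ := by
    have : MemLp (D i) 2 μ := by
      simpa only [D, div_eq_mul_inv, Pi.sub_apply] using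
        ((hT (N i)).sub (memLp_const _)).mul_const (((i : ℝ) ^ 2)⁻¹)
    exact this.integrable_sq
  have hDvar (i : ℕ) : ∫ ω, D i ω ^ 2 ∂μ ≤ C * (1 + Real.log 2) * (1 / (i : ℝ) ^ 2) := by
    rcases Nat.eq_zero_or_pos i with rfl | hi
    · simp [D]
    have hi' : (1 : ℝ) ≤ i := by exact_mod_cast hi
    simp only [D, div_pow]
    rw [integral_div, ← variance_eq_integral (hT _).aestronglyMeasurable.aemeasurable]
    have h1 := hvar (N i) Nat.one_le_two_pow
    rw [hlogN] at h1
    have h2 : C * (1 + (i : ℝ) ^ 2 * Real.log 2) ≤ C * ((i : ℝ) ^ 2 * (1 + Real.log 2)) := by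
      gcongr
      nlinarith
    rw [div_le_iff₀ (by positivity)]
    refine (h1.trans h2).trans (le_of_eq ?_)
    field_simp
  have hsummable : Summable fun i : ℕ => ∫ ω, D i ω ^ 2 ∂μ :=
    Summable.of_nonneg_of_le (fun i => integral_nonneg fun ω => sq_nonneg _) hDvar
      ((Real.summable_one_div_nat_pow.2 one_lt_two).mul_left _)
  -- The expected sum of the `D i ω ^ 2` is finite, so almost surely the series converges and its
  -- terms tend to `0`; this replaces Chebyshev and Borel–Cantelli.
  have hfin : ∫⁻ ω, ∑' i, ENNReal.ofReal (D i ω ^ 2) ∂μ ≠ ⊤ := by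
    rw [lintegral_tsum fun i => (hDint i).aestronglyMeasurable.aemeasurable.ennreal_ofReal]
    simp_rw [← ofReal_integral_eq_lintegral_ofReal (hDint _) (ae_of_all _ fun ω => sq_nonneg _)]
    exact hsummable.tsum_ofReal_ne_top
  have hae := ae_lt_top' (AEMeasurable.tsum fun i =>
    (hDint i).aestronglyMeasurable.aemeasurable.ennreal_ofReal) hfin
  filter_upwards [hae] with ω hω
  have hD0 : Tendsto (fun i => D i ω) atTop (𝓝 0) := by
    have h1 := ENNReal.tendsto_atTop_zero_of_tsum_ne_top hω.ne
    have h2 := (ENNReal.tendsto_toReal ENNReal.zero_ne_top).comp h1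
    have h3 : Tendsto (fun i => D i ω ^ 2) atTop (𝓝 0) := by
      refine h2.congr fun i => ?_
      simp [ENNReal.toReal_ofReal, sq_nonneg]
    have h4 := h3.sqrt
    simp only [Real.sqrt_sq_eq_abs, Real.sqrt_zero] at h4
    exact tendsto_zero_iff_abs_tendsto_zero _ |>.2 h4
  have hsub : Tendsto (fun i => T (N i) ω / ((i ^ 2 : ℕ) : ℝ)) atTop (𝓝 (c * Real.log 2)) := by
    have h1 := hD0.add ((hmean.comp hNtop).mul_const (Real.log 2))
    rw [zero_add] at h1
    refine h1.congr' ?_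
    filter_upwards [eventually_gt_atTop 0] with i hi
    have hi' : (0 : ℝ) < i := by exact_mod_cast hi
    simp only [Function.comp, hlogN, D]
    push_cast
    field_simp
    ring
  -- In the variable `m = log₂ n` the normalisation is linear, so the interpolation lemma for
  -- monotone sequences divided by their index applies along `m = i²`.
  have hdyadic : Tendsto (fun m : ℕ => T (2 ^ m) ω / m) atTop (𝓝 (c * Real.log 2)) := by
    refine tendsto_div_of_monotone_of_exists_subseq_tendsto_div (fun m => T (2 ^ m) ω) _
      (fun m n hmn => hmono ω (Nat.pow_le_pow_right two_pos hmn)) fun a ha =>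
      ⟨fun i => i ^ 2, ?_, tendsto_pow_atTop two_ne_zero, hsub⟩
    have h1 : Tendsto (fun n : ℕ => (1 + ((n : ℝ))⁻¹) ^ 2) atTop (𝓝 1) := by
      simpa using (((tendsto_inv_atTop_zero (𝕜 := ℝ)).comp
        tendsto_natCast_atTop_atTop).const_add 1).pow 2
    filter_upwards [h1.eventually (gt_mem_nhds ha), eventually_gt_atTop 0] with n hn hn0
    have hn' : (0 : ℝ) < n := by exact_mod_cast hn0
    push_cast
    calc ((n : ℝ) + 1) ^ 2 = (1 + (n : ℝ)⁻¹) ^ 2 * n ^ 2 := by field_simp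
      _ ≤ a * n ^ 2 := by gcongr
  have hlog2top : Tendsto (fun n : ℕ => Nat.log 2 n) atTop atTop := by
    refine tendsto_atTop.2 fun b => ?_
    filter_upwards [eventually_ge_atTop (2 ^ b)] with n hn
    exact Nat.le_log_of_pow_le one_lt_two hn
  have hshift : Tendsto (fun m : ℕ => ((m : ℝ) + 1) / m) atTop (𝓝 1) := by
    have h1 : Tendsto (fun m : ℕ => 1 + ((m : ℝ))⁻¹) atTop (𝓝 1) := by
      simpa using ((tendsto_inv_atTop_zero (𝕜 := ℝ)).comp
        tendsto_natCast_atTop_atTop).const_add 1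
    refine h1.congr' ?_
    filter_upwards [eventually_gt_atTop 0] with m hm
    have : (0 : ℝ) < m := by exact_mod_cast hm
    field_simp
  have hlow : Tendsto (fun m : ℕ => T (2 ^ m) ω / (((m : ℝ) + 1) * Real.log 2)) atTop (𝓝 c) := by
    have h1 := (hdyadic.div hshift one_ne_zero).div_const (Real.log 2)
    rw [div_one, mul_div_cancel_right₀ _ hl2.ne'] at h1
    refine h1.congr' ?_
    filter_upwards [eventually_gt_atTop 0] with m hm
    have : (0 : ℝ) < m := by exact_mod_cast hm
    simp only [Pi.div_apply]
    field_simp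
  have hup : Tendsto (fun m : ℕ => T (2 ^ (m + 1)) ω / ((m : ℝ) * Real.log 2)) atTop (𝓝 c) := by
    have h0 := (tendsto_add_atTop_iff_nat 1).2 hdyadic
    have h1 := (h0.mul hshift).div_const (Real.log 2)
    rw [mul_one, mul_div_cancel_right₀ _ hl2.ne'] at h1
    refine h1.congr' ?_
    filter_upwards [eventually_gt_atTop 0] with m hm
    have : (0 : ℝ) < m := by exact_mod_cast hm
    push_cast
    field_simp
  -- Sandwich with `2 ^ m ≤ n < 2 ^ (m + 1)`, `m = Nat.log 2 n`, pairing the smaller numerator with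
  -- the larger denominator and conversely.
  refine tendsto_of_tendsto_of_tendsto_of_le_of_le' (hlow.comp hlog2top) (hup.comp hlog2top) ?_ ?_
  · filter_upwards [eventually_ge_atTop 2] with n hn
    have hn1 : (1 : ℝ) < n := by exact_mod_cast hn
    have h1 : 2 ^ Nat.log 2 n ≤ n := Nat.pow_log_le_self 2 (by omega)
    have h2 : n < 2 ^ (Nat.log 2 n + 1) := Nat.lt_pow_succ_log_self one_lt_two n
    have h3 : Real.log n ≤ ((Nat.log 2 n : ℝ) + 1) * Real.log 2 := by
      have : (n : ℝ) ≤ 2 ^ (Nat.log 2 n + 1) := by exact_mod_cast h2.le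
      have h4 := Real.log_le_log (by positivity) this
      rw [Real.log_pow] at h4
      exact_mod_cast h4
    exact div_le_div₀ (hnonneg _ _) (hmono ω h1) (Real.log_pos hn1) h3
  · filter_upwards [eventually_ge_atTop 2] with n hn
    have h1 : 2 ^ Nat.log 2 n ≤ n := Nat.pow_log_le_self 2 (by omega)
    have h2 : n < 2 ^ (Nat.log 2 n + 1) := Nat.lt_pow_succ_log_self one_lt_two n
    have h0 : 0 < Nat.log 2 n := Nat.log_pos one_lt_two hn
    have h0' : (0 : ℝ) < Nat.log 2 n := by exact_mod_cast h0
    have h3 : (Nat.log 2 n : ℝ) * Real.log 2 ≤ Real.log n := by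
      have : (2 : ℝ) ^ Nat.log 2 n ≤ n := by exact_mod_cast h1
      have h4 := Real.log_le_log (by positivity) this
      rwa [Real.log_pow] at h4
    exact div_le_div₀ (hnonneg _ _) (hmono ω h2.le) (by positivity) h3

/-! ### Lattice laws and decay of their characteristic functions. -/

theorem isConcentratedOnLattice_iff {Ω : Type*} [MeasurableSpace Ω] {μ : Measure Ω}
    [IsProbabilityMeasure μ] {Y : Ω → ℝ} (hY : Measurable Y) {h b : ℝ} (hh : 0 < h) :
    IsConcentratedOnLattice μ Y h b ↔ ∀ᵐ ω ∂μ, ∃ k : ℤ, Y ω = k * h + b := by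
  have hm (k : ℤ) : MeasurableSet {ω | Y ω = (k : ℝ) * h + b} :=
    measurableSet_eq_fun hY measurable_const
  have hd : Pairwise (Function.onFun Disjoint fun k : ℤ => {ω | Y ω = (k : ℝ) * h + b}) := by
    intro k l hkl
    refine Set.disjoint_left.2 fun ω hk hl => hkl ?_
    simp only [Set.mem_ofPred_eq] at hk hl
    have : (k : ℝ) = l := mul_right_cancel₀ hh.ne' (by linarith)
    exact_mod_cast this
  rw [IsConcentratedOnLattice, ← measure_iUnion hd hm,
    ← mem_ae_iff_prob_eq_one (MeasurableSet.iUnion hm)]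
  refine iff_of_eq (congrArg (· ∈ ae μ) ?_)
  ext ω
  simp

theorem charFun_map_apply {Ω : Type*} [MeasurableSpace Ω] {μ : Measure Ω} {Y : Ω → ℝ}
    (hY : Measurable Y) (t : ℝ) :
    charFun (μ.map Y) t = ∫ ω, Complex.exp (t * Y ω * Complex.I) ∂μ := by
  rw [charFun_apply_real, integral_map hY.aemeasurable (by fun_prop)]

theorem charFun_map_eq_charFun_map_div {Ω : Type*} [MeasurableSpace Ω] {μ : Measure Ω} {Y : Ω → ℝ}
    (hY : Measurable Y) {σ : ℝ} (hσ : σ ≠ 0) (t : ℝ) :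
    charFun (μ.map Y) t = charFun (μ.map fun ω => Y ω / σ) (σ * t) := by
  rw [charFun_map_apply hY, charFun_map_apply (by fun_prop)]
  refine integral_congr_ae (ae_of_all _ fun ω => ?_)
  have : (σ : ℂ) ≠ 0 := by exact_mod_cast hσ
  simp only
  congr 1
  push_cast
  field_simp

theorem integrable_exp_ofReal_mul_I {Ω : Type*} [MeasurableSpace Ω] {μ : Measure Ω}
    [IsFiniteMeasure μ] {f : Ω → ℝ} (hf : Measurable f) :
    Integrable (fun ω => Complex.exp (f ω * Complex.I)) μ :=
  (integrable_const (1 : ℝ)).mono' (by fun_prop)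
    (ae_of_all _ fun ω => (Complex.norm_exp_ofReal_mul_I _).le)

/-- If the characteristic function has modulus one at `t`, the variable is concentrated on a
progression of span `2π / t`. -/
theorem exists_isConcentratedOnLattice_of_norm_charFun_eq_one {Ω : Type*} [MeasurableSpace Ω]
    {μ : Measure Ω} [IsProbabilityMeasure μ] {Y : Ω → ℝ} (hY : Measurable Y) {t : ℝ} (ht : 0 < t)
    (h1 : ‖charFun (μ.map Y) t‖ = 1) :
    ∃ b, IsConcentratedOnLattice μ Y (2 * Real.pi / t) b := by
  obtain ⟨θ, hθ⟩ := (Complex.norm_eq_one_iff _).1 h1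
  refine ⟨θ / t, (isConcentratedOnLattice_iff hY (by positivity)).2 ?_⟩
  -- Rotating by the argument `θ` makes the expectation equal to `1`; then `1 - cos (t Y - θ)` is
  -- nonnegative with integral `0`, which forces `t Y - θ ∈ 2πℤ` almost surely.
  have hint : Integrable (fun ω => Complex.exp ((t * Y ω - θ : ℝ) * Complex.I)) μ :=
    integrable_exp_ofReal_mul_I (by fun_prop)
  have h2 : ∫ ω, Complex.exp ((t * Y ω - θ : ℝ) * Complex.I) ∂μ = 1 := by
    have (ω : Ω) : Complex.exp ((t * Y ω - θ : ℝ) * Complex.I) =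
        Complex.exp (t * Y ω * Complex.I) * Complex.exp (-(θ * Complex.I)) := by
      rw [← Complex.exp_add]
      congr 1
      push_cast
      ring
    simp_rw [this]
    rw [integral_mul_const, ← charFun_map_apply hY, ← hθ, ← Complex.exp_add, add_neg_cancel,
      Complex.exp_zero]
  have h3 : ∫ ω, Real.cos (t * Y ω - θ) ∂μ = 1 := by
    have := integral_re hint
    simp only [RCLike.re_to_complex, h2, Complex.exp_ofReal_mul_I_re, Complex.one_re] at this
    exact this
  have hcos : Integrable (fun ω => Real.cos (t * Y ω - θ)) μ :=
    (integrable_const (1 : ℝ)).mono' (by fun_prop) (ae_of_all _ fun ω => Real.abs_cos_le_one _)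
  have h4 : ∫ ω, (1 - Real.cos (t * Y ω - θ)) ∂μ = 0 := by
    rw [integral_sub (integrable_const _) hcos, h3]
    simp
  rw [integral_eq_zero_iff_of_nonneg (fun ω => sub_nonneg.2 (Real.cos_le_one _))
    ((integrable_const _).sub hcos)] at h4
  filter_upwards [h4] with ω hω
  obtain ⟨n, hn⟩ := (Real.cos_eq_one_iff (t * Y ω - θ)).1 (by simpa using (sub_eq_zero.1 hω).symm)
  refine ⟨n, ?_⟩
  field_simp
  linarith

/-- Modulus one at `t ≤ π / h` would give a progression of span `2π / t ≥ 2h`, against maximality of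
`h`. -/
theorem norm_charFun_lt_one_of_isLatticeValued {Ω : Type*} [MeasurableSpace Ω] {μ : Measure Ω}
    [IsProbabilityMeasure μ] {Y : Ω → ℝ} (hY : Measurable Y) {h b : ℝ}
    (hl : IsLatticeValued μ Y h b) {t : ℝ} (ht : 0 < t) (hth : t ≤ Real.pi / h) :
    ‖charFun (μ.map Y) t‖ < 1 := by
  have := Measure.isProbabilityMeasure_map (μ := μ) hY.aemeasurable
  refine lt_of_le_of_ne (norm_charFun_le_one t) fun h1 => ?_
  obtain ⟨b', hb'⟩ := exists_isConcentratedOnLattice_of_norm_charFun_eq_one hY ht h1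
  have h2 := hl.maximal _ _ (by positivity) hb'
  rw [div_le_iff₀ ht] at h2
  rw [le_div_iff₀ hl.pos] at hth
  nlinarith [Real.pi_pos]

/-- Gaussian decay of the characteristic function of a centred lattice variable on the fundamental
interval. -/
theorem exists_norm_charFun_le_exp {Ω : Type*} [MeasurableSpace Ω] {μ : Measure Ω}
    [IsProbabilityMeasure μ] {Y : Ω → ℝ} (hY : Measurable Y) {h b σ : ℝ}
    (hl : IsLatticeValued μ Y h b) (hmean : ∫ ω, Y ω ∂μ = 0) (hσ : 0 < σ)
    (hvar : ∫ ω, Y ω ^ 2 ∂μ = σ ^ 2) :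
    ∃ c > 0, ∀ t : ℝ, |t| ≤ Real.pi / h → ‖charFun (μ.map Y) t‖ ≤ Real.exp (-c * t ^ 2) := by
  have := Measure.isProbabilityMeasure_map (μ := μ) hY.aemeasurable
  have hh := hl.pos
  suffices H : ∃ c > 0, ∀ t : ℝ, 0 ≤ t → t ≤ Real.pi / h →
      ‖charFun (μ.map Y) t‖ ≤ Real.exp (-c * t ^ 2) by
    obtain ⟨c, hc, H⟩ := H
    refine ⟨c, hc, fun t ht => ?_⟩
    have h1 := H |t| (abs_nonneg t) ht
    rw [sq_abs] at h1
    rcases abs_choice t with h2 | h2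
    · rwa [h2] at h1
    · rwa [h2, charFun_neg, RCLike.norm_conj] at h1
  have hZ0 : ∫ ω, Y ω / σ ∂μ = 0 := by rw [integral_div, hmean, zero_div]
  have hZ1 : ∫ ω, (Y ω / σ) ^ 2 ∂μ = 1 := by
    simp_rw [div_pow]
    rw [integral_div, hvar, div_self (by positivity)]
  have htaylor := taylor_charFun_two (P := μ) (X := fun ω => Y ω / σ) (by fun_prop) hZ0 hZ1
  obtain ⟨δ, hδ, hnear⟩ := Metric.eventually_nhds_iff.1 (htaylor.bound (by norm_num : (0:ℝ) < 1/4))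
  -- For `0 ≤ t ≤ δ'`, `σ t < δ` validates the Taylor bound and `σ t ≤ 1` keeps `1 - (σ t)² / 2`
  -- positive. The error `(σ t)² / 4` then leaves `1 - (σ t)² / 4`.
  set δ' := min (δ / 2) 1 / σ with hδ'
  have hδ'0 : 0 < δ' := by positivity
  have hsmall : ∀ t : ℝ, 0 ≤ t → t ≤ δ' →
      ‖charFun (μ.map Y) t‖ ≤ Real.exp (-(σ ^ 2 / 4) * t ^ 2) := by
    intro t ht0 ht
    rw [hδ', le_div_iff₀ hσ, le_min_iff] at ht
    have hst : 0 ≤ σ * t := by positivity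
    have h1 := hnear (y := σ * t) (by rw [Real.dist_eq, sub_zero, abs_of_nonneg hst]; linarith)
    rw [← charFun_map_eq_charFun_map_div hY hσ.ne', Real.norm_of_nonneg (by positivity)] at h1
    have h2 : ‖(1 - ((σ * t : ℝ) : ℂ) ^ 2 / 2)‖ = 1 - (σ * t) ^ 2 / 2 := by
      rw [← Real.norm_of_nonneg (r := 1 - (σ * t) ^ 2 / 2) (by nlinarith), ← Complex.norm_real]
      push_cast
      rfl
    have h3 := norm_sub_norm_le (charFun (μ.map Y) t) (1 - ((σ * t : ℝ) : ℂ) ^ 2 / 2)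
    have h4 := Real.add_one_le_exp (-(σ ^ 2 / 4) * t ^ 2)
    nlinarith
  rcases le_total (Real.pi / h) δ' with hle | hle
  · exact ⟨σ ^ 2 / 4, by positivity, fun t h0 h1 => hsmall t h0 (h1.trans hle)⟩
  obtain ⟨t₀, ht₀, hmax⟩ := (isCompact_Icc (a := δ') (b := Real.pi / h)).exists_isMaxOn
    (Set.nonempty_Icc.2 hle) (f := fun t => ‖charFun (μ.map Y) t‖)
    (continuous_charFun.norm.continuousOn)
  have hr := norm_charFun_lt_one_of_isLatticeValued hY hl (hδ'0.trans_le ht₀.1) ht₀.2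
  set r := ‖charFun (μ.map Y) t₀‖
  have hA : 0 < Real.pi / h := by positivity
  -- The second constant serves `[δ', π / h]`: there `c t² ≤ 1 - r`, and `r ≤ exp (-(1 - r))`.
  refine ⟨min (σ ^ 2 / 4) ((1 - r) / (Real.pi / h) ^ 2),
    lt_min (by positivity) (div_pos (by linarith) (by positivity)), fun t h0 h1 => ?_⟩
  rcases le_total t δ' with ht | ht
  · refine (hsmall t h0 ht).trans (Real.exp_le_exp.2 ?_)
    have := min_le_left (σ ^ 2 / 4) ((1 - r) / (Real.pi / h) ^ 2)
    nlinarith [sq_nonneg t]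
  · have h2 : ‖charFun (μ.map Y) t‖ ≤ r := hmax ⟨ht, h1⟩
    have h3 := Real.add_one_le_exp (-(1 - r))
    refine (h2.trans (by linarith : r ≤ Real.exp (-(1 - r)))).trans (Real.exp_le_exp.2 ?_)
    have h4 := min_le_right (σ ^ 2 / 4) ((1 - r) / (Real.pi / h) ^ 2)
    have h5 : t ^ 2 ≤ (Real.pi / h) ^ 2 := by gcongr
    have h6 : min (σ ^ 2 / 4) ((1 - r) / (Real.pi / h) ^ 2) * t ^ 2 ≤
        (1 - r) / (Real.pi / h) ^ 2 * (Real.pi / h) ^ 2 :=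
      mul_le_mul h4 h5 (sq_nonneg t) (div_nonneg (by linarith) (by positivity))
    rw [div_mul_cancel₀ _ (by positivity)] at h6
    linarith

/-! ### Fourier inversion and integral estimates. -/

theorem integral_exp_int_mul {h : ℝ} (hh : 0 < h) (k : ℤ) :
    ∫ t in -(Real.pi / h)..Real.pi / h, Complex.exp ((t * (k * h) : ℝ) * Complex.I) =
      if k = 0 then ((2 * Real.pi / h : ℝ) : ℂ) else 0 := by
  split_ifs with hk
  · subst hk
    simp
    ring_nf
  · have hk' : (k : ℂ) ≠ 0 := by exact_mod_cast hk
    have hh' : (h : ℂ) ≠ 0 := by exact_mod_cast hh.ne'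
    have (t : ℝ) : Complex.exp ((t * (k * h) : ℝ) * Complex.I) =
        Complex.exp ((k * h * Complex.I) * t) := by
      congr 1
      push_cast
      ring
    simp_rw [this]
    rw [integral_exp_mul_complex (by simp [hk', hh']), div_eq_zero_iff]
    left
    rw [sub_eq_zero, Complex.exp_eq_exp_iff_exists_int]
    refine ⟨k, ?_⟩
    push_cast
    field_simp
    ring

/-- Fourier inversion for point probabilities of a lattice variable. -/
theorem measureReal_eq_integral_charFun {Ω : Type*} [MeasurableSpace Ω] {μ : Measure Ω}
    [IsProbabilityMeasure μ] {Y : Ω → ℝ} (hY : Measurable Y) {h x : ℝ} (hh : 0 < h)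
    (hl : ∀ᵐ ω ∂μ, ∃ k : ℤ, Y ω = k * h + x) :
    (μ.real {ω | Y ω = x} : ℂ) = (h / (2 * Real.pi) : ℝ) *
      ∫ t in -(Real.pi / h)..Real.pi / h,
        charFun (μ.map Y) t * Complex.exp (-(t * x : ℝ) * Complex.I) := by
  have h1 (t : ℝ) : charFun (μ.map Y) t * Complex.exp (-(t * x : ℝ) * Complex.I) =
      ∫ ω, Complex.exp ((t * (Y ω - x) : ℝ) * Complex.I) ∂μ := by
    rw [charFun_map_apply hY, ← integral_mul_const]
    refine integral_congr_ae (ae_of_all _ fun ω => ?_)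
    simp only [← Complex.exp_add]
    congr 1
    push_cast
    ring
  simp_rw [h1]
  rw [intervalIntegral_integral_swap]
  swap
  · have : IsFiniteMeasure (volume.restrict (Set.uIoc (-(Real.pi / h)) (Real.pi / h))) :=
      inferInstanceAs (IsFiniteMeasure (volume.restrict (Set.Ioc _ _)))
    exact integrable_exp_ofReal_mul_I (f := fun p : ℝ × Ω => p.1 * (Y p.2 - x)) (by fun_prop)
  have h2 : ∀ᵐ ω ∂μ, (∫ t in -(Real.pi / h)..Real.pi / h,
      Complex.exp ((t * (Y ω - x) : ℝ) * Complex.I)) =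
      {ω | Y ω = x}.indicator (fun _ => ((2 * Real.pi / h : ℝ) : ℂ)) ω := by
    filter_upwards [hl] with ω ⟨k, hk⟩
    have h3 : Y ω - x = k * h := by linarith
    rw [h3, integral_exp_int_mul hh, Set.indicator_apply]
    congr 1
    simp only [Set.mem_ofPred_eq, eq_iff_iff]
    rw [hk]
    simp [hh.ne']
  rw [integral_congr_ae h2, integral_indicator (measurableSet_eq_fun hY measurable_const),
    setIntegral_const, Complex.real_smul, ← Complex.ofReal_mul, ← Complex.ofReal_mul]
  congr 1
  field_simp

/-- Integrate `|exp (i s) - 1| ≤ |s|`. The factor `|t|` is what later makes the covariance small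
when `j` is much smaller than `k`. -/
theorem norm_charFun_mul_exp_sub_one_le {Ω : Type*} [MeasurableSpace Ω] {μ : Measure Ω}
    [IsProbabilityMeasure μ] {Y : Ω → ℝ} (hY : Measurable Y) (hint : Integrable Y μ) (y t : ℝ) :
    ‖charFun (μ.map Y) t * Complex.exp (-(t * y : ℝ) * Complex.I) - 1‖ ≤
      |t| * ∫ ω, |Y ω - y| ∂μ := by
  have h1 : charFun (μ.map Y) t * Complex.exp (-(t * y : ℝ) * Complex.I) - 1 =
      ∫ ω, (Complex.exp ((t * (Y ω - y) : ℝ) * Complex.I) - 1) ∂μ := by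
    rw [integral_sub (integrable_exp_ofReal_mul_I (by fun_prop)) (integrable_const _),
      charFun_map_apply hY, ← integral_mul_const]
    simp only [integral_const, probReal_univ, one_smul]
    congr 1
    refine integral_congr_ae (ae_of_all _ fun ω => ?_)
    simp only [← Complex.exp_add]
    congr 1
    push_cast
    ring
  rw [h1, ← integral_const_mul]
  refine norm_integral_le_of_norm_le
    ((hint.sub (integrable_const y)).abs.const_mul _) (ae_of_all _ fun ω => ?_)
  rw [mul_comm _ Complex.I]
  refine Real.norm_exp_I_mul_ofReal_sub_one_le.trans (le_of_eq ?_)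
  rw [Real.norm_eq_abs, abs_mul]

theorem norm_intervalIntegral_le_of_le_exp {f : ℝ → ℂ} {A B c : ℝ} (hA : 0 ≤ A) (hB : 0 ≤ B)
    (hc : 0 < c) (hf : ∀ t : ℝ, |t| ≤ A → ‖f t‖ ≤ B * Real.exp (-c * t ^ 2)) :
    ‖∫ t in -A..A, f t‖ ≤ B * √(Real.pi / c) := by
  have hi : Integrable fun t : ℝ => B * Real.exp (-c * t ^ 2) :=
    (integrable_exp_neg_mul_sq hc).const_mul B
  calc ‖∫ t in -A..A, f t‖ ≤ ∫ t in -A..A, B * Real.exp (-c * t ^ 2) :=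
        intervalIntegral.norm_integral_le_of_norm_le (by linarith)
          (ae_of_all _ fun t ht => hf t (abs_le.2 ⟨ht.1.le, ht.2⟩)) hi.intervalIntegrable
    _ ≤ ∫ t, B * Real.exp (-c * t ^ 2) := by
        rw [intervalIntegral.integral_of_le (by linarith)]
        exact setIntegral_le_integral hi (ae_of_all _ fun t => by positivity)
    _ = B * √(Real.pi / c) := by rw [integral_const_mul, integral_gaussian]

/-- Half of the Gaussian absorbs the linear factor, since `s * exp (-s² / 2) ≤ 1` for `s = |t| √c`.
-/
theorem abs_mul_exp_neg_mul_sq_le {c : ℝ} (hc : 0 < c) (t : ℝ) :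
    |t| * Real.exp (-c * t ^ 2) ≤ 1 / √c * Real.exp (-(c / 2) * t ^ 2) := by
  have h1 : Real.exp (-c * t ^ 2) =
      Real.exp (-(c / 2) * t ^ 2) * Real.exp (-(c / 2) * t ^ 2) := by
    rw [← Real.exp_add]
    congr 1
    ring
  have hs : 0 < √c := Real.sqrt_pos.2 hc
  have h2 : |t| * √c * Real.exp (-(c / 2) * t ^ 2) ≤ 1 := by
    have h3 := Real.add_one_le_exp (c / 2 * t ^ 2)
    rw [neg_mul, Real.exp_neg, ← div_eq_mul_inv, div_le_one (Real.exp_pos _)]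
    nlinarith [sq_nonneg (|t| * √c - 1), Real.sq_sqrt hc.le, sq_abs t]
  rw [h1, ← mul_assoc]
  gcongr
  rw [le_div_iff₀ hs]
  linarith

/-- The local limit theorem, in terms of the Fourier inversion formula. -/
theorem tendsto_sqrt_mul_integral_pow {φ : ℝ → ℂ} (hφ : Continuous φ) {A c s y : ℝ} (hA : 0 < A)
    (hc : 0 < c) (hs : 0 < s) (hdecay : ∀ t : ℝ, |t| ≤ A → ‖φ t‖ ≤ Real.exp (-c * t ^ 2))
    (hlim : ∀ u : ℝ, Tendsto (fun n : ℕ => φ ((√n)⁻¹ * u) ^ n) atTop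
      (𝓝 (Complex.exp (-(s * u) ^ 2 / 2))))
    {x : ℕ → ℝ} (hx : Tendsto (fun n : ℕ => x n / √n) atTop (𝓝 y)) :
    Tendsto (fun n : ℕ => (√n : ℂ) *
        ∫ t in -A..A, φ t ^ n * Complex.exp (-(t * x n : ℝ) * Complex.I)) atTop
      (𝓝 ((√(2 * Real.pi) / s * Real.exp (-(y / s) ^ 2 / 2) : ℝ) : ℂ)) := by
  -- The integrand after the substitution `u = √n * t`, whose Jacobian absorbs the prefactor `√n`.
  -- The decay bound becomes the dominating function `exp (-c u²)`, independent of `n`.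
  set F : ℕ → ℝ → ℂ := fun n u => φ ((√n)⁻¹ * u) ^ n *
    Complex.exp (-(u * (x n / √n) : ℝ) * Complex.I) with hF
  have hsqrt : Tendsto (fun n : ℕ => √(n : ℝ)) atTop atTop :=
    Real.tendsto_sqrt_atTop.comp tendsto_natCast_atTop_atTop
  have hlimit : ∫ u : ℝ, Complex.exp (-(s * u) ^ 2 / 2) * Complex.exp (-(u * y : ℝ) * Complex.I) =
      ((√(2 * Real.pi) / s * Real.exp (-(y / s) ^ 2 / 2) : ℝ) : ℂ) := by
    have h1 (u : ℝ) : Complex.exp (-(s * u) ^ 2 / 2) * Complex.exp (-(u * y : ℝ) * Complex.I) =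
        Complex.exp ((-(s ^ 2 / 2 : ℝ) : ℂ) * u ^ 2 + (-(y * Complex.I)) * u + 0) := by
      rw [← Complex.exp_add]
      congr 1
      push_cast
      ring
    have hs' : (s : ℂ) ≠ 0 := by exact_mod_cast hs.ne'
    have h2 : (Real.pi : ℂ) / - -((s ^ 2 / 2 : ℝ) : ℂ) = ((2 * Real.pi / s ^ 2 : ℝ) : ℂ) := by
      push_cast
      field_simp
    have h3 : (0 : ℂ) - (-(y * Complex.I)) ^ 2 / (4 * -((s ^ 2 / 2 : ℝ) : ℂ)) =
        ((-(y / s) ^ 2 / 2 : ℝ) : ℂ) := by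
      push_cast
      rw [neg_sq, mul_pow, Complex.I_sq]
      field_simp
      ring
    simp_rw [h1]
    rw [integral_cexp_quadratic (by
      rw [← Complex.ofReal_neg, Complex.ofReal_re]; nlinarith), h2, h3,
      Complex.ofReal_mul, Complex.ofReal_exp,
      show (1 / 2 : ℂ) = ((1 / 2 : ℝ) : ℂ) by norm_num, ← Complex.ofReal_cpow (by positivity),
      ← Real.sqrt_eq_rpow, Real.sqrt_div (by positivity), Real.sqrt_sq hs.le]
  rw [← hlimit]
  have hconv : Tendsto (fun n : ℕ => ∫ u,
      (Set.Ioc (-(A * √n)) (A * √n)).indicator (F n) u) atTop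
      (𝓝 (∫ u : ℝ, Complex.exp (-(s * u) ^ 2 / 2) *
        Complex.exp (-(u * y : ℝ) * Complex.I))) := by
    refine tendsto_integral_filter_of_dominated_convergence (fun u => Real.exp (-c * u ^ 2))
      (Eventually.of_forall fun n => ?_) ?_ (integrable_exp_neg_mul_sq hc) (ae_of_all _ fun u => ?_)
    · exact (Continuous.aestronglyMeasurable (by fun_prop)).indicator measurableSet_Ioc
    · filter_upwards [eventually_gt_atTop 0] with n hn
      have hn' : (0 : ℝ) < n := by exact_mod_cast hn
      have hsn : 0 < √(n : ℝ) := Real.sqrt_pos.2 hn'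
      refine ae_of_all _ fun u => ?_
      rw [Set.indicator_apply]
      split_ifs with hu
      · rw [hF]
        simp only [norm_mul, norm_pow]
        rw [← Complex.ofReal_neg, Complex.norm_exp_ofReal_mul_I, mul_one]
        have h1 : |(√(n : ℝ))⁻¹ * u| ≤ A := by
          rw [abs_mul, abs_of_pos (inv_pos.2 hsn), inv_mul_le_iff₀ hsn]
          refine abs_le.2 ⟨?_, ?_⟩ <;> linarith [hu.1, hu.2]
        refine (pow_le_pow_left₀ (norm_nonneg _) (hdecay _ h1) n).trans (le_of_eq ?_)
        rw [← Real.exp_nat_mul]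
        congr 1
        rw [mul_pow, inv_pow, Real.sq_sqrt hn'.le]
        field_simp
      · simpa using (Real.exp_pos _).le
    · have h1 : Tendsto (fun n => F n u) atTop (𝓝 (Complex.exp (-(s * u) ^ 2 / 2) *
          Complex.exp (-(u * y : ℝ) * Complex.I))) := by
        refine (hlim u).mul ?_
        have hcont : Continuous fun v : ℝ => Complex.exp (-(u * v : ℝ) * Complex.I) := by fun_prop
        exact (hcont.tendsto y).comp hx
      refine h1.congr' ?_
      filter_upwards [hsqrt.eventually_gt_atTop (|u| / A)] with n hn
      rw [div_lt_iff₀ hA] at hn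
      rw [Set.indicator_of_mem]
      obtain ⟨h2, h3⟩ := abs_lt.1 hn
      constructor <;> linarith
  refine hconv.congr' ?_
  filter_upwards [eventually_gt_atTop 0] with n hn
  have hn' : (0 : ℝ) < n := by exact_mod_cast hn
  have hsn : 0 < √(n : ℝ) := Real.sqrt_pos.2 hn'
  rw [integral_indicator measurableSet_Ioc,
    ← intervalIntegral.integral_of_le (by nlinarith)]
  have h1 := intervalIntegral.integral_comp_mul_left (a := -(A * √n)) (b := A * √n)
    (fun t => φ t ^ n * Complex.exp (-(t * x n : ℝ) * Complex.I)) (inv_pos.2 hsn).ne'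
  rw [inv_inv, show (√(n : ℝ))⁻¹ * -(A * √n) = -A by field_simp,
    show (√(n : ℝ))⁻¹ * (A * √n) = A by field_simp, Complex.real_smul] at h1
  rw [← h1]
  refine intervalIntegral.integral_congr fun u _ => ?_
  simp only [hF]
  congr 4
  ring_nf

/-! ### Weakly correlated indicators. -/

/-- The almost sure logarithmic average of the indicators of weakly correlated events. -/
theorem ae_tendsto_log_average_indicator {Ω : Type*} [MeasurableSpace Ω] {μ : Measure Ω}
    [IsProbabilityMeasure μ] {A : ℕ → Set Ω} (hA : ∀ k, MeasurableSet (A k)) {c C : ℝ}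
    (hlim : Tendsto (fun k : ℕ => √k * μ.real (A k)) atTop (𝓝 c))
    (hcov : ∀ j k : ℕ, 1 ≤ j → j < k →
      |μ.real (A j ∩ A k) - μ.real (A j) * μ.real (A k)| ≤
        C * (1 / √((k - j : ℕ) : ℝ) * (1 / √(k : ℝ)))) :
    ∀ᵐ ω ∂μ, Tendsto (fun n : ℕ => (1 / Real.log (n : ℝ)) *
      ∑ k ∈ Finset.Icc 1 n, (A k).indicator (fun _ => (1 : ℝ)) ω * (1 / √(k : ℝ)))
      atTop (𝓝 c) := by
  have hC : 0 ≤ C := by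
    have h1 := (abs_nonneg _).trans (hcov 1 2 le_rfl one_lt_two)
    exact nonneg_of_mul_nonneg_left h1 (by norm_num)
  have hint (k : ℕ) : ∫ ω, (A k).indicator (fun _ => (1 : ℝ)) ω ∂μ = μ.real (A k) := by
    rw [integral_indicator (hA k)]
    simp
  have hmem (k : ℕ) : MemLp ((A k).indicator fun _ => (1 : ℝ)) 2 μ :=
    (memLp_const (1 : ℝ)).indicator (hA k)
  set Z : ℕ → Ω → ℝ := fun k ω => (A k).indicator (fun _ => (1 : ℝ)) ω * (1 / √(k : ℝ)) with hZ
  have hZmem (k : ℕ) : MemLp (Z k) 2 μ := (hmem k).mul_const _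
  have hZnonneg (k : ℕ) (ω : Ω) : 0 ≤ Z k ω :=
    mul_nonneg (Set.indicator_nonneg (fun _ _ => zero_le_one) _) (by positivity)
  have hind (j k : ℕ) : cov[(A j).indicator fun _ => (1 : ℝ), (A k).indicator fun _ => (1 : ℝ); μ]
      = μ.real (A j ∩ A k) - μ.real (A j) * μ.real (A k) := by
    rw [covariance_eq_sub (hmem j) (hmem k), hint, hint]
    congr 1
    have : ((A j).indicator fun _ => (1 : ℝ)) * ((A k).indicator fun _ => (1 : ℝ)) =
        (A j ∩ A k).indicator fun _ => (1 : ℝ) := by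
      ext ω
      rw [Pi.mul_apply, ← Set.inter_indicator_mul]
      simp
    rw [this, integral_indicator ((hA j).inter (hA k))]
    simp
  have hZcov (j k : ℕ) : cov[Z j, Z k; μ] =
      (μ.real (A j ∩ A k) - μ.real (A j) * μ.real (A k)) * (1 / √(j : ℝ)) * (1 / √(k : ℝ)) := by
    rw [hZ, covariance_mul_const_left, covariance_mul_const_right, hind]
    ring
  have hdiag (k : ℕ) : cov[Z k, Z k; μ] ≤ 1 / (k : ℝ) := by
    rw [hZcov, Set.inter_self, mul_assoc, one_div_mul_one_div_rev, Real.mul_self_sqrt (by positivity)]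
    have h1 : μ.real (A k) ≤ 1 := measureReal_le_one
    have h2 : 0 ≤ μ.real (A k) := measureReal_nonneg
    have h3 : (0 : ℝ) ≤ 1 / k := by positivity
    nlinarith [mul_nonneg h2 h2]
  have hrow (k : ℕ) : ∑ j ∈ Finset.Ico 1 k, cov[Z j, Z k; μ] ≤ 4 * C * (1 / (k : ℝ)) := by
    calc _ ≤ ∑ j ∈ Finset.Ico 1 k, C * (1 / (k : ℝ)) *
          (1 / √(j : ℝ) * (1 / √((k - j : ℕ) : ℝ))) := by
          refine Finset.sum_le_sum fun j hj => ?_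
          rw [Finset.mem_Ico] at hj
          rw [hZcov]
          have h1 := (le_abs_self _).trans (hcov j k hj.1 hj.2)
          have h2 : 1 / (k : ℝ) = 1 / √(k : ℝ) * (1 / √(k : ℝ)) := by
            rw [one_div_mul_one_div_rev, Real.mul_self_sqrt (by positivity)]
          rw [h2]
          calc _ ≤ C * (1 / √((k - j : ℕ) : ℝ) * (1 / √(k : ℝ))) * (1 / √(j : ℝ)) *
                (1 / √(k : ℝ)) := by gcongr
            _ = _ := by ring
      _ ≤ 4 * C * (1 / (k : ℝ)) := by
          rw [← Finset.mul_sum]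
          have := mul_le_mul_of_nonneg_left (sum_Ico_inv_sqrt_mul_inv_sqrt_le k)
            (by positivity : 0 ≤ C * (1 / (k : ℝ)))
          linarith
  set T : ℕ → Ω → ℝ := fun n ω => ∑ k ∈ Finset.Icc 1 n, Z k ω with hT
  have hTmem (n : ℕ) : MemLp (T n) 2 μ := memLp_finsetSum _ fun k _ => hZmem k
  have hrec (n : ℕ) : T (n + 1) = T n + Z (n + 1) := by
    ext ω
    simp [hT, Finset.sum_Icc_succ_top]
  -- Adding the index `k` costs at most `1 / k` for the diagonal term plus twice the row sum `4 C /
  -- k`.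
  have hvar (n : ℕ) : Var[T n; μ] ≤ (1 + 8 * C) * ∑ k ∈ Finset.Icc 1 n, 1 / (k : ℝ) := by
    induction n with
    | zero =>
      have : T 0 = 0 := by ext; simp [hT]
      simp [this]
    | succ n ih =>
      rw [hrec, variance_add (hTmem n) (hZmem _), Finset.sum_Icc_succ_top (by omega)]
      have h1 := hdiag (n + 1)
      rw [covariance_self (hZmem _).aestronglyMeasurable.aemeasurable] at h1
      have h2 : cov[T n, Z (n + 1); μ] = ∑ j ∈ Finset.Ico 1 (n + 1), cov[Z j, Z (n + 1); μ] := by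
        rw [hT, covariance_fun_sum_left' (fun j _ => hZmem j) (hZmem _)]
        rfl
      have h3 := hrow (n + 1)
      rw [← h2] at h3
      linarith
  have hmean (n : ℕ) : ∫ ω, T n ω ∂μ =
      ∑ k ∈ Finset.Icc 1 n, (√k * μ.real (A k)) / k := by
    rw [hT, integral_finsetSum _ fun k _ => (hZmem k).integrable (by norm_num)]
    refine Finset.sum_congr rfl fun k hk => ?_
    rw [hZ, integral_mul_const, hint]
    have hk' : (0 : ℝ) < k := by exact_mod_cast (Finset.mem_Icc.1 hk).1
    have h1 : 0 < √(k : ℝ) := Real.sqrt_pos.2 hk'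
    have h2 : √(k : ℝ) ^ 2 = k := Real.sq_sqrt hk'.le
    field_simp
    rw [h2]
  have key := ae_tendsto_div_log_of_variance_le (μ := μ) (T := T) (C := 1 + 8 * C) (c := c) hTmem
    (fun ω => monotone_nat_of_le_succ fun n => by
      rw [hrec, Pi.add_apply]
      linarith [hZnonneg (n + 1) ω])
    (fun n ω => Finset.sum_nonneg fun k _ => hZnonneg k ω)
    (fun n hn => (hvar n).trans
      (mul_le_mul_of_nonneg_left (sum_Icc_inv_le_one_add_log n) (by positivity)))
    (by simpa only [hmean] using tendsto_log_average hlim)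
  filter_upwards [key] with ω hω
  refine hω.congr fun n => ?_
  rw [hT, one_div, div_eq_inv_mul]

/-! ### The lattice random walk. -/

/-- The steps `X 0, X 1, …` are independent copies of a centred `h`-lattice variable with shift `b`
and variance `σ ^ 2`. -/
structure IsCenteredLatticeWalk {Ω : Type*} [MeasurableSpace Ω] (μ : Measure Ω) (X : ℕ → Ω → ℝ)
    (h b σ : ℝ) : Prop where
  meas : ∀ i, Measurable (X i)
  indep : iIndepFun X μ
  ident : ∀ i, IdentDistrib (X i) (X 0) μ μ
  lattice : IsLatticeValued μ (X 0) h b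
  mean : ∫ ω, X 0 ω ∂μ = 0
  sigma_pos : 0 < σ
  var : ∫ ω, (X 0 ω) ^ 2 ∂μ = σ ^ 2

/-- The Fourier inversion formula for the probability that a sum of `n` independent `h`-lattice
variables with characteristic function `φ` equals `x`. -/
noncomputable def latticeInversion (φ : ℝ → ℂ) (h : ℝ) (n : ℕ) (x : ℝ) : ℂ :=
  (h / (2 * Real.pi) : ℝ) *
    ∫ t in -(Real.pi / h)..Real.pi / h, φ t ^ n * Complex.exp (-(t * x : ℝ) * Complex.I)

theorem abs_latticeApprox_sub_le {h : ℝ} (hh : 0 < h) (b : ℝ) (n : ℕ) (t : ℝ) :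
    |latticeApprox h b n t - t| ≤ h := by
  have h1 := Int.floor_le ((t - n * b) / h)
  have h2 := (Int.lt_floor_add_one ((t - n * b) / h)).le
  rw [le_div_iff₀ hh] at h1
  rw [div_le_iff₀ hh] at h2
  rw [latticeApprox, abs_le]
  constructor <;> linarith

namespace IsCenteredLatticeWalk

variable {Ω : Type*} [MeasurableSpace Ω] {μ : Measure Ω} {X : ℕ → Ω → ℝ} {h b σ : ℝ}

theorem measurable_sum (hX : IsCenteredLatticeWalk μ X h b σ) (s : Finset ℕ) :
    Measurable fun ω => ∑ i ∈ s, X i ω :=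
  Finset.measurable_fun_sum _ fun i _ => hX.meas i

theorem charFun_sum (hX : IsCenteredLatticeWalk μ X h b σ) (s : Finset ℕ) :
    charFun (μ.map fun ω => ∑ i ∈ s, X i ω) = charFun (μ.map (X 0)) ^ s.card := by
  rw [(hX.indep.restrict _).charFun_map_fun_finsetSum_eq_prod
    (fun i _ => (hX.meas i).aemeasurable)]
  simp [fun i => (hX.ident i).map_eq]

theorem memLp (hX : IsCenteredLatticeWalk μ X h b σ) (i : ℕ) : MemLp (X i) 2 μ := by
  rw [(hX.ident i).memLp_iff, memLp_two_iff_integrable_sq (hX.meas 0).aestronglyMeasurable]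
  -- The Bochner integral of a non-integrable function is `0`, so a nonzero second moment already
  -- gives square integrability.
  refine .of_integral_ne_zero ?_
  rw [hX.var]
  exact (pow_pos hX.sigma_pos 2).ne'

theorem memLp_partialSum (hX : IsCenteredLatticeWalk μ X h b σ) (n : ℕ) :
    MemLp (partialSum X n) 2 μ :=
  memLp_finsetSum _ fun i _ => hX.memLp i

theorem measurable_partialSum (hX : IsCenteredLatticeWalk μ X h b σ) (n : ℕ) :
    Measurable (partialSum X n) :=
  hX.measurable_sum _

theorem measurableSet_hitEvent (hX : IsCenteredLatticeWalk μ X h b σ) (a : ℝ) (k : ℕ) :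
    MeasurableSet (hitEvent X h b σ a k) :=
  measurableSet_eq_fun (hX.measurable_partialSum k) measurable_const

variable [IsProbabilityMeasure μ]

theorem ae_sum_mem_lattice (hX : IsCenteredLatticeWalk μ X h b σ) (s : Finset ℕ) :
    ∀ᵐ ω ∂μ, ∃ k : ℤ, ∑ i ∈ s, X i ω = k * h + s.card * b := by
  have h0 := (isConcentratedOnLattice_iff (hX.meas 0) hX.lattice.pos).1 hX.lattice.concentrated
  have hm : MeasurableSet {x : ℝ | ∃ k : ℤ, x = k * h + b} := by
    rw [show {x : ℝ | ∃ k : ℤ, x = k * h + b} = ⋃ k : ℤ, {(k * h + b : ℝ)} by ext; simp [eq_comm]]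
    exact MeasurableSet.iUnion fun k => measurableSet_singleton _
  have hi : ∀ᵐ ω ∂μ, ∀ i, ∃ k : ℤ, X i ω = k * h + b :=
    ae_all_iff.2 fun i => (hX.ident i).symm.ae_mem_snd hm h0
  filter_upwards [hi] with ω hω
  choose f hf using hω
  refine ⟨∑ i ∈ s, f i, ?_⟩
  simp_rw [hf]
  push_cast
  rw [Finset.sum_add_distrib, Finset.sum_mul, Finset.sum_const, nsmul_eq_mul]

theorem measureReal_sum_eq (hX : IsCenteredLatticeWalk μ X h b σ) (s : Finset ℕ) {x : ℝ}
    (hx : ∃ k : ℤ, x = k * h + s.card * b) :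
    (μ.real {ω | ∑ i ∈ s, X i ω = x} : ℂ) =
      latticeInversion (charFun (μ.map (X 0))) h s.card x := by
  obtain ⟨l, rfl⟩ := hx
  rw [measureReal_eq_integral_charFun (hX.measurable_sum s) hX.lattice.pos, hX.charFun_sum]
  · rfl
  · filter_upwards [hX.ae_sum_mem_lattice s] with ω ⟨k, hk⟩
    refine ⟨k - l, ?_⟩
    rw [hk]
    push_cast
    ring

theorem integral_partialSum_sq (hX : IsCenteredLatticeWalk μ X h b σ) (n : ℕ) :
    ∫ ω, partialSum X n ω ^ 2 ∂μ = n * σ ^ 2 := by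
  have hmean (i : ℕ) : ∫ ω, X i ω ∂μ = 0 := (hX.ident i).integral_eq.trans hX.mean
  have h0 : ∫ ω, partialSum X n ω ∂μ = 0 := by
    simp only [partialSum]
    rw [integral_finsetSum _ fun i _ => (hX.memLp i).integrable (by norm_num)]
    simp [hmean]
  rw [← variance_of_integral_eq_zero (hX.measurable_partialSum n).aemeasurable h0,
    show partialSum X n = ∑ i ∈ Finset.range n, X i by ext; simp [partialSum],
    IndepFun.variance_sum (fun i _ => hX.memLp i) fun i _ j _ hij => hX.indep.indepFun hij]
  have (i : ℕ) : Var[X i; μ] = σ ^ 2 := by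
    rw [variance_of_integral_eq_zero (hX.meas i).aemeasurable (hmean i), ← hX.var]
    exact ((hX.ident i).comp (measurable_id.pow_const 2)).integral_eq
  simp [this]

/-- Cauchy–Schwarz, in the form that `|S_n|` has nonnegative variance. -/
theorem integral_abs_partialSum_le (hX : IsCenteredLatticeWalk μ X h b σ) (n : ℕ) :
    ∫ ω, |partialSum X n ω| ∂μ ≤ σ * √n := by
  have h1 := variance_nonneg (fun ω => |partialSum X n ω|) μ
  rw [variance_eq_sub (X := fun ω => |partialSum X n ω|) (hX.memLp_partialSum n).abs] at h1
  simp only [Pi.pow_apply, sq_abs, hX.integral_partialSum_sq] at h1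
  refine abs_le_of_sq_le_sq' ?_ (mul_nonneg hX.sigma_pos.le (Real.sqrt_nonneg _)) |>.2
  rw [mul_pow, Real.sq_sqrt (Nat.cast_nonneg n)]
  linarith

theorem integral_abs_partialSum_sub_le (hX : IsCenteredLatticeWalk μ X h b σ) (a : ℝ) {n : ℕ}
    (hn : 1 ≤ n) :
    ∫ ω, |partialSum X n ω - latticeApprox h b n (a * σ * √n)| ∂μ ≤
      (σ + |a| * σ + h) * √n := by
  have hint : Integrable (partialSum X n) μ := (hX.memLp_partialSum n).integrable (by norm_num)
  set x := latticeApprox h b n (a * σ * √n)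
  have hs : 1 ≤ √(n : ℝ) := Real.one_le_sqrt.2 (by exact_mod_cast hn)
  have hx : |x| ≤ (|a| * σ + h) * √n := by
    have h1 := abs_latticeApprox_sub_le hX.lattice.pos b n (a * σ * √n)
    have h2 := abs_sub_abs_le_abs_sub x (a * σ * √n)
    rw [abs_mul, abs_mul, abs_of_pos hX.sigma_pos, abs_of_nonneg (Real.sqrt_nonneg _)] at h2
    nlinarith [hX.lattice.pos]
  calc _ ≤ ∫ ω, (|partialSum X n ω| + |x|) ∂μ :=
        integral_mono (hint.sub (integrable_const x)).abs (hint.abs.add (integrable_const _))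
          fun ω => abs_sub _ _
    _ = ∫ ω, |partialSum X n ω| ∂μ + |x| := by
        rw [integral_add hint.abs (integrable_const _)]
        simp
    _ ≤ (σ + |a| * σ + h) * √n := by
        have := hX.integral_abs_partialSum_le n
        linarith

theorem measureReal_hitEvent (hX : IsCenteredLatticeWalk μ X h b σ) (a : ℝ) (k : ℕ) :
    (μ.real (hitEvent X h b σ a k) : ℂ) = latticeInversion (charFun (μ.map (X 0))) h k
      (latticeApprox h b k (a * σ * √k)) := by
  have := hX.measureReal_sum_eq (Finset.range k) (x := latticeApprox h b k (a * σ * √k))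
    ⟨_, by rw [Finset.card_range]; rfl⟩
  rwa [Finset.card_range] at this

/-- The local limit theorem along the lattice approximations of `a σ √k`. -/
theorem tendsto_sqrt_mul_measureReal_hitEvent (hX : IsCenteredLatticeWalk μ X h b σ) (a : ℝ) :
    Tendsto (fun k : ℕ => √k * μ.real (hitEvent X h b σ a k)) atTop
      (𝓝 (h / (√(2 * Real.pi) * σ) * Real.exp (-a ^ 2 / 2))) := by
  have hh := hX.lattice.pos
  have hσ := hX.sigma_pos
  have := Measure.isProbabilityMeasure_map (μ := μ) (hX.meas 0).aemeasurable
  obtain ⟨c, hc, hdecay⟩ :=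
    exists_norm_charFun_le_exp (hX.meas 0) hX.lattice hX.mean hX.sigma_pos hX.var
  have hsqrt : Tendsto (fun n : ℕ => √(n : ℝ)) atTop atTop :=
    Real.tendsto_sqrt_atTop.comp tendsto_natCast_atTop_atTop
  have hx : Tendsto (fun n : ℕ => latticeApprox h b n (a * σ * √n) / √n) atTop (𝓝 (a * σ)) := by
    rw [tendsto_iff_dist_tendsto_zero]
    refine squeeze_zero' (Eventually.of_forall fun n => dist_nonneg) ?_
      (hsqrt.const_div_atTop h)
    filter_upwards [hsqrt.eventually_gt_atTop 0] with n hn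
    have h1 := abs_latticeApprox_sub_le hh b n (a * σ * √n)
    rw [Real.dist_eq, div_sub' hn.ne', abs_div, abs_of_pos hn, mul_comm √(n : ℝ)]
    gcongr
  have hlim (u : ℝ) : Tendsto (fun n : ℕ => charFun (μ.map (X 0)) ((√n)⁻¹ * u) ^ n) atTop
      (𝓝 (Complex.exp (-(σ * u) ^ 2 / 2))) := by
    -- The central limit theorem is for unit variance: apply it to `X 0 / σ` at the frequency `σ u`.
    have h1 := tendsto_charFun_inv_sqrt_mul_pow (P := μ) (X := fun ω => X 0 ω / σ)
      ((hX.meas 0).div_const σ).aemeasurable (by rw [integral_div, hX.mean, zero_div])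
      (by
        simp only [Pi.pow_apply, div_pow]
        rw [integral_div, hX.var, div_self (by positivity)]) (σ * u)
    rw [Complex.ofReal_mul] at h1
    refine h1.congr fun n => ?_
    rw [charFun_map_eq_charFun_map_div (hX.meas 0) hσ.ne', mul_left_comm]
  have key := (tendsto_sqrt_mul_integral_pow continuous_charFun (by positivity) hc hσ hdecay hlim
    hx).const_mul ((h / (2 * Real.pi) : ℝ) : ℂ)
  have key' := (Complex.continuous_re.tendsto _).comp key
  convert key' using 1
  · ext k
    rw [Function.comp_apply, mul_left_comm]
    rw [← latticeInversion, ← hX.measureReal_hitEvent a k, ← Complex.ofReal_mul, Complex.ofReal_re]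
  · rw [← Complex.ofReal_mul, Complex.ofReal_re, mul_div_cancel_right₀ _ hσ.ne', ← mul_assoc]
    congr 2
    have h1 : √(2 * Real.pi) ^ 2 = 2 * Real.pi := Real.sq_sqrt (by positivity)
    have h2 : 0 < √(2 * Real.pi) := by positivity
    field_simp
    exact h1.symm

/-- Given `S_j = y`, hitting `x` at time `k` means that the increment over `[j, k)` equals `x - y`.
It is independent of `S_j`, and `x - y` lies in the lattice of sums of `k - j` steps, so inversion
applies. -/
theorem measureReal_hitEvent_inter (hX : IsCenteredLatticeWalk μ X h b σ) (a : ℝ) {j k : ℕ}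
    (hjk : j ≤ k) :
    (μ.real (hitEvent X h b σ a j ∩ hitEvent X h b σ a k) : ℂ) =
      μ.real (hitEvent X h b σ a j) * latticeInversion (charFun (μ.map (X 0))) h (k - j)
        (latticeApprox h b k (a * σ * √k) - latticeApprox h b j (a * σ * √j)) := by
  set x := latticeApprox h b k (a * σ * √k) with hx
  set y := latticeApprox h b j (a * σ * √j) with hy
  have hcard : (Finset.Ico j k).card = k - j := Nat.card_Ico j k
  have h1 := hX.measureReal_sum_eq (Finset.Ico j k) (x := x - y)
    ⟨⌊(a * σ * √k - k * b) / h⌋ - ⌊(a * σ * √j - j * b) / h⌋, by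
      rw [hcard, hx, hy, latticeApprox, latticeApprox, Nat.cast_sub hjk]
      push_cast
      ring⟩
  rw [hcard] at h1
  rw [← h1, ← Complex.ofReal_mul]
  have hset : hitEvent X h b σ a j ∩ hitEvent X h b σ a k =
      hitEvent X h b σ a j ∩ {ω | ∑ i ∈ Finset.Ico j k, X i ω = x - y} := by
    ext ω
    have h2 : partialSum X k ω = partialSum X j ω + ∑ i ∈ Finset.Ico j k, X i ω :=
      (Finset.sum_range_add_sum_Ico _ hjk).symm
    simp only [hitEvent, Set.mem_inter_iff, Set.mem_ofPred_eq, ← hx, ← hy, h2]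
    refine and_congr_right fun h3 => ?_
    rw [h3, eq_sub_iff_add_eq']
  have hind : IndepFun (partialSum X j) (fun ω => ∑ i ∈ Finset.Ico j k, X i ω) μ := by
    have h2 := hX.indep.indepFun_finset (Finset.range j) (Finset.Ico j k)
      (by
        rw [Finset.range_eq_Ico]
        exact Finset.Ico_disjoint_Ico_consecutive 0 j k) hX.meas
    have h3 := h2.comp (φ := fun f : Finset.range j → ℝ => ∑ i, f i)
      (ψ := fun f : Finset.Ico j k → ℝ => ∑ i, f i) (by fun_prop) (by fun_prop)
    convert h3 using 1
    · ext ω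
      exact (Finset.sum_coe_sort (Finset.range j) fun i => X i ω).symm
    · ext ω
      exact (Finset.sum_coe_sort (Finset.Ico j k) fun i => X i ω).symm
  rw [hset]
  congr 1
  have h4 := hind.measure_inter_preimage_eq_mul {y} {x - y} (measurableSet_singleton _)
    (measurableSet_singleton _)
  simp only [measureReal_def, ← ENNReal.toReal_mul]
  exact congrArg ENNReal.toReal h4

end IsCenteredLatticeWalk

/-! ### Covariance estimates. -/

theorem norm_latticeInversion_le {φ : ℝ → ℂ} {h c : ℝ} (hh : 0 < h) (hc : 0 < c)
    (hdecay : ∀ t : ℝ, |t| ≤ Real.pi / h → ‖φ t‖ ≤ Real.exp (-c * t ^ 2)) {n : ℕ} (hn : 1 ≤ n)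
    (x : ℝ) :
    ‖latticeInversion φ h n x‖ ≤ h / (2 * Real.pi) * √(Real.pi / c) * (1 / √n) := by
  have hn' : (0 : ℝ) < n := by exact_mod_cast hn
  have h1 := norm_intervalIntegral_le_of_le_exp (A := Real.pi / h) (B := 1) (c := c * n)
    (f := fun t => φ t ^ n * Complex.exp (-(t * x : ℝ) * Complex.I))
    (by positivity) zero_le_one (by positivity) fun t ht => by
      rw [norm_mul, norm_pow, ← Complex.ofReal_neg, Complex.norm_exp_ofReal_mul_I, mul_one, one_mul]
      refine (pow_le_pow_left₀ (norm_nonneg _) (hdecay t ht) n).trans (le_of_eq ?_)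
      rw [← Real.exp_nat_mul]
      congr 1
      ring
  rw [latticeInversion, norm_mul, Complex.norm_real, Real.norm_of_nonneg (by positivity), mul_assoc]
  gcongr
  refine h1.trans (le_of_eq ?_)
  rw [one_mul, ← div_div, Real.sqrt_div (by positivity)]
  ring

/-- With `m = k - j`, the difference of integrands is `φ ^ m * exp (-it(x - y))` times `φ ^ j * exp
(-ity) - 1`. The second factor contributes `|t| * D`; against a Gaussian of width `1 / √m` the extra
`|t|` improves `1 / √m` to `1 / m`. -/
theorem norm_latticeInversion_sub_le {φ : ℝ → ℂ} (hφ : Continuous φ) {h c D : ℝ} (hh : 0 < h)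
    (hc : 0 < c) (hdecay : ∀ t : ℝ, |t| ≤ Real.pi / h → ‖φ t‖ ≤ Real.exp (-c * t ^ 2))
    {j k : ℕ} (hjk : j < k) {x y : ℝ} (hD : 0 ≤ D)
    (hj : ∀ t : ℝ, ‖φ t ^ j * Complex.exp (-(t * y : ℝ) * Complex.I) - 1‖ ≤ |t| * D) :
    ‖latticeInversion φ h k x - latticeInversion φ h (k - j) (x - y)‖ ≤
      h / (2 * Real.pi) * √(2 * Real.pi) / c * D * (1 / ((k - j : ℕ) : ℝ)) := by
  set m := k - j with hm
  have hm' : (0 : ℝ) < m := by exact_mod_cast (by omega : 0 < k - j)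
  have hcm : 0 < c * m := by positivity
  have h0 : latticeInversion φ h k x - latticeInversion φ h m (x - y) =
      (h / (2 * Real.pi) : ℝ) * ∫ t in -(Real.pi / h)..Real.pi / h,
        φ t ^ m * Complex.exp (-(t * (x - y) : ℝ) * Complex.I) *
          (φ t ^ j * Complex.exp (-(t * y : ℝ) * Complex.I) - 1) := by
    rw [latticeInversion, latticeInversion, ← mul_sub, ← intervalIntegral.integral_sub]
    · congr 1
      refine intervalIntegral.integral_congr fun t _ => ?_
      rw [show k = m + j by omega, pow_add, show (-(t * x : ℝ) * Complex.I : ℂ) =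
        -(t * (x - y) : ℝ) * Complex.I + -(t * y : ℝ) * Complex.I by push_cast; ring,
        Complex.exp_add]
      ring
    · exact Continuous.intervalIntegrable (by fun_prop) _ _
    · exact Continuous.intervalIntegrable (by fun_prop) _ _
  have h1 := norm_intervalIntegral_le_of_le_exp (A := Real.pi / h) (B := D * (1 / √(c * m)))
    (c := c * m / 2)
    (f := fun t => φ t ^ m * Complex.exp (-(t * (x - y) : ℝ) * Complex.I) *
          (φ t ^ j * Complex.exp (-(t * y : ℝ) * Complex.I) - 1))
    (by positivity) (by positivity) (by positivity) fun t ht => by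
      rw [norm_mul, norm_mul, norm_pow, ← Complex.ofReal_neg, Complex.norm_exp_ofReal_mul_I,
        mul_one]
      have h2 : ‖φ t‖ ^ m ≤ Real.exp (-(c * m) * t ^ 2) := by
        refine (pow_le_pow_left₀ (norm_nonneg _) (hdecay t ht) m).trans (le_of_eq ?_)
        rw [← Real.exp_nat_mul]
        congr 1
        ring
      calc _ ≤ Real.exp (-(c * m) * t ^ 2) * (|t| * D) := by
            gcongr
            exact hj t
        _ = D * (|t| * Real.exp (-(c * m) * t ^ 2)) := by ring
        _ ≤ D * (1 / √(c * m) * Real.exp (-(c * m / 2) * t ^ 2)) := by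
            exact mul_le_mul_of_nonneg_left (abs_mul_exp_neg_mul_sq_le hcm t) hD
        _ = _ := by ring
  rw [h0, norm_mul, Complex.norm_real, Real.norm_of_nonneg (by positivity)]
  calc _ ≤ h / (2 * Real.pi) * (D * (1 / √(c * m)) * √(Real.pi / (c * m / 2))) := by gcongr
    _ = _ := by
      rw [show Real.pi / (c * m / 2) = 2 * Real.pi / (c * m) by field_simp,
        Real.sqrt_div (by positivity)]
      have h3 : √(c * m) * √(c * m) = c * m := Real.mul_self_sqrt hcm.le
      calc _ = h / (2 * Real.pi) * √(2 * Real.pi) * D / (√(c * m) * √(c * m)) := by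
            field_simp
        _ = _ := by
            rw [h3]
            field_simp

/-- The hitting events at two distant times are almost uncorrelated. -/
theorem IsCenteredLatticeWalk.exists_abs_cov_hitEvent_le {Ω : Type*} [MeasurableSpace Ω]
    {μ : Measure Ω} [IsProbabilityMeasure μ] {X : ℕ → Ω → ℝ} {h b σ : ℝ}
    (hX : IsCenteredLatticeWalk μ X h b σ) (a : ℝ) :
    ∃ C, ∀ j k : ℕ, 1 ≤ j → j < k →
      |μ.real (hitEvent X h b σ a j ∩ hitEvent X h b σ a k) -
        μ.real (hitEvent X h b σ a j) * μ.real (hitEvent X h b σ a k)| ≤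
        C * (1 / √((k - j : ℕ) : ℝ) * (1 / √(k : ℝ))) := by
  have hh := hX.lattice.pos
  have hσ := hX.sigma_pos
  have := Measure.isProbabilityMeasure_map (μ := μ) (hX.meas 0).aemeasurable
  obtain ⟨c, hc, hdecay⟩ :=
    exists_norm_charFun_le_exp (hX.meas 0) hX.lattice hX.mean hX.sigma_pos hX.var
  set φ := charFun (μ.map (X 0)) with hφ
  set C₁ := h / (2 * Real.pi) * √(Real.pi / c)
  set C₂ := h / (2 * Real.pi) * √(2 * Real.pi) / c
  set C₃ := σ + |a| * σ + h
  have hC₁ : 0 ≤ C₁ := by positivity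
  have hC₂ : 0 ≤ C₂ := by positivity
  have hC₃ : 0 ≤ C₃ := by positivity
  have hp (k : ℕ) (hk : 1 ≤ k) : μ.real (hitEvent X h b σ a k) ≤ C₁ * (1 / √k) := by
    have h1 := norm_latticeInversion_le hh hc hdecay hk (latticeApprox h b k (a * σ * √k))
    rw [← hX.measureReal_hitEvent, Complex.norm_real] at h1
    exact (le_abs_self _).trans h1
  -- The sum of the constants from the cases `m ≤ j` and `j ≤ m`. The outer `2` comes from `1 / √l ≤
  -- 2 / √k` for `l` the larger of `j` and `m`, where `k ≤ 2 * l`.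
  refine ⟨2 * (C₁ * (2 * C₁) + C₁ * (C₂ * C₃)), fun j k hj hjk => ?_⟩
  set m := k - j with hm
  have hm1 : 1 ≤ m := by omega
  set x := latticeApprox h b k (a * σ * √k)
  set y := latticeApprox h b j (a * σ * √j)
  have hj0 : 0 < √(j : ℝ) := Real.sqrt_pos.2 (by exact_mod_cast hj)
  have hm0 : 0 < √(m : ℝ) := Real.sqrt_pos.2 (by exact_mod_cast hm1)
  have hk0 : 0 < √(k : ℝ) := Real.sqrt_pos.2 (by exact_mod_cast (by omega : 0 < k))
  have heq : |μ.real (hitEvent X h b σ a j ∩ hitEvent X h b σ a k) -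
        μ.real (hitEvent X h b σ a j) * μ.real (hitEvent X h b σ a k)| =
      μ.real (hitEvent X h b σ a j) *
        ‖latticeInversion φ h k x - latticeInversion φ h m (x - y)‖ := by
    rw [← Real.norm_eq_abs, ← Complex.norm_real, Complex.ofReal_sub, Complex.ofReal_mul,
      hX.measureReal_hitEvent_inter a hjk.le, hX.measureReal_hitEvent a k, ← mul_sub, norm_mul,
      Complex.norm_real, Real.norm_of_nonneg measureReal_nonneg, norm_sub_rev]
  rw [heq]
  have hpj := hp j hj
  have hsum {u v : ℝ} (hu : 0 < u) (h1 : √(k : ℝ) ≤ 2 * u) : 1 / u ≤ 2 * (1 / √(k : ℝ)) := by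
    rw [mul_one_div, div_le_div_iff₀ hu hk0]
    linarith
  have hsqrt2 {l : ℕ} (hl : k ≤ 2 * l) : √(k : ℝ) ≤ 2 * √(l : ℝ) := by
    refine Real.sqrt_le_iff.2 ⟨by positivity, ?_⟩
    rw [mul_pow, Real.sq_sqrt (Nat.cast_nonneg l)]
    have : (k : ℝ) ≤ 2 * l := by exact_mod_cast hl
    nlinarith [Nat.cast_nonneg (α := ℝ) l]
  rcases le_total m j with hmj | hmj
  -- Here `j` is comparable to `k`: `P(A j)` supplies `1 / √k`, and bounding the two inversions
  -- separately supplies `1 / √m`.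
  · have h1 : ‖latticeInversion φ h k x - latticeInversion φ h m (x - y)‖ ≤
        2 * C₁ * (1 / √m) := by
      have h2 := norm_latticeInversion_le hh hc hdecay (by omega : 1 ≤ k) x
      have h3 := norm_latticeInversion_le hh hc hdecay hm1 (x - y)
      have h4 : 1 / √(k : ℝ) ≤ 1 / √(m : ℝ) :=
        one_div_le_one_div_of_le hm0 (Real.sqrt_le_sqrt (by exact_mod_cast Nat.sub_le k j))
      have h5 := mul_le_mul_of_nonneg_left h4 hC₁
      linarith [norm_sub_le (latticeInversion φ h k x) (latticeInversion φ h m (x - y))]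
    have h6 := hsum (v := 0) hj0 (hsqrt2 (by omega))
    calc _ ≤ C₁ * (1 / √j) * (2 * C₁ * (1 / √m)) := by gcongr
      _ ≤ C₁ * (2 * (1 / √(k : ℝ))) * (2 * C₁ * (1 / √m)) := by gcongr
      _ = 2 * (C₁ * (2 * C₁)) * (1 / √m * (1 / √k)) := by ring
      _ ≤ _ := by
        gcongr
        linarith [mul_nonneg hC₁ (mul_nonneg hC₂ hC₃)]
  -- Here `m` is comparable to `k`. Since `E|S_j - y| ≤ C₃ √j`, the difference is `O(√j / m)`; the
  -- `√j` cancels against `P(A j) ≤ C₁ / √j`, leaving `1 / m`.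
  · have h1 := norm_latticeInversion_sub_le (φ := φ) (x := x) (y := y) (D := C₃ * √j)
      continuous_charFun hh hc hdecay hjk (by positivity) fun t => by
        have h2 := norm_charFun_mul_exp_sub_one_le (hX.measurable_partialSum j)
          ((hX.memLp_partialSum j).integrable (by norm_num)) y t
        have h3 : charFun (μ.map (partialSum X j)) t = φ t ^ j := by
          have := congrFun (hX.charFun_sum (Finset.range j)) t
          rwa [Finset.card_range] at this
        rw [h3] at h2
        exact h2.trans (mul_le_mul_of_nonneg_left (hX.integral_abs_partialSum_sub_le a hj)
          (abs_nonneg t))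
    rw [← hm] at h1
    have h6 := hsum (v := 0) hm0 (hsqrt2 (by omega))
    have h7 : 1 / (m : ℝ) = 1 / √m * (1 / √m) := by
      rw [one_div_mul_one_div_rev, Real.mul_self_sqrt (Nat.cast_nonneg m)]
    calc _ ≤ C₁ * (1 / √j) * (C₂ * (C₃ * √j) * (1 / m)) := by gcongr
      _ = C₁ * (C₂ * C₃) * (1 / √m) * (1 / √m) := by
        rw [h7]
        field_simp
      _ ≤ C₁ * (C₂ * C₃) * (1 / √m) * (2 * (1 / √k)) := by gcongr
      _ = 2 * (C₁ * (C₂ * C₃)) * (1 / √m * (1 / √k)) := by ring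
      _ ≤ _ := by
        gcongr
        linarith [mul_nonneg hC₁ hC₁]

theorem mainTheorem10 {Ω : Type*} [MeasurableSpace Ω] (μ : Measure Ω) [IsProbabilityMeasure μ]
    (X : ℕ → Ω → ℝ) (h b σ a : ℝ)
    (hX_meas : ∀ i, Measurable (X i))
    (hX_indep : iIndepFun X μ)
    (hX_ident : ∀ i, IdentDistrib (X i) (X 0) μ μ)
    (hX_lattice : IsLatticeValued μ (X 0) h b)
    (hX_third : Integrable (fun ω => |X 0 ω| ^ 3) μ)
    (hX_mean : ∫ ω, X 0 ω ∂μ = 0)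
    (hσ : 0 < σ)
    (hX_var : ∫ ω, (X 0 ω) ^ 2 ∂μ = σ ^ 2) :
    ∀ᵐ ω ∂μ, Tendsto
      (fun n : ℕ => (1 / Real.log (n : ℝ)) *
        ∑ k ∈ Finset.Icc 1 n,
          (hitEvent X h b σ a k).indicator (fun _ => (1 : ℝ)) ω * (1 / √(k : ℝ)))
      atTop
      (𝓝 (h / (√(2 * Real.pi) * σ) * Real.exp (-a ^ 2 / 2))) := by
  have hX : IsCenteredLatticeWalk μ X h b σ :=
    ⟨hX_meas, hX_indep, hX_ident, hX_lattice, hX_mean, hσ, hX_var⟩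
  obtain ⟨C, hC⟩ := hX.exists_abs_cov_hitEvent_le a
  exact ae_tendsto_log_average_indicator (hX.measurableSet_hitEvent a)
    (hX.tendsto_sqrt_mul_measureReal_hitEvent a) hC
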